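/- All maps are continuous. For metrizable spaces $X$ and $Y$, the set $C(X,Y)$ of all maps $X\to Y$ carries the limitation topology: a neighbourhood base at $f\in C(X,Y)$ is given by the sets $B(f,\mathcal U)=\{g\in C(X,Y):\ \forall x\in X\ \exists U\in\mathcal U,\ \{f(x),g(x)\}\subset U\}$, where $\mathcal U$ runs over all open covers of $Y$. A metrizable space $P$ is an ANR (absolute neighbourhood retract) if, whenever $P$ is embedded as a closed subset of a metrizable space $Z$, it is a retract of an open neighbourhood of itself in $Z$. Let $X$ be a metrizable space, let $(Y,\varrho)$ be a metric space, and let $P\subset Y$ be a subset which, with the subspace topology, is a completely metrizable ANR. Let $A,A_1,A_2,A_3,\ldots$ be closed subsets of $X$ such that $A\cap A_n=\varnothing\neq A_n$ for every $n$. For every $n$ let $G_n$ be a dense $G_\delta$ subset of $C(A_n,P)$, and let $\lambda\colon X\setminus A\to(0,\infty)$ be a map with $\inf\lambda(A_n)>0$ for every $n$. Then for every map $f\colon X\to Y$ with $f(X\setminus A)\subset P$ and every neighbourhood $G$ of $f|_{X\setminus A}$ in $C(X\setminus A,P)$ there is a map $h\colon X\to Y$ such that \begin{enumerate} \item $h|_A=f|_A$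 and $h(X\setminus A)\subset P$; \item $h|_{A_n}\in G_n$ for every $n$; \item $h|_{X\setminus A}\in G$ and $\varrho(h(x),f(x))<\lambda(x)$ for every $x\in X\setminus A$. \end{enumerate} -/

import Mathlib

open Set Topology

universe u v

/-- A metrizable space `P` is an absolute neighbourhood retract (for metrizable spaces): whenever it
is embedded as a closed subset of a metrizable space `Z`, it is a retract of an open neighbourhood
of (the image of) `P` in `Z`.  The retraction `r` is written as a map to `P`, with `r (e p) = p`. -/
def IsANR (P : Type v) [TopologicalSpace P] : Prop :=
  TopologicalSpace.MetrizableSpace P ∧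
    ∀ (Z : Type v) [TopologicalSpace Z] [TopologicalSpace.MetrizableSpace Z] (e : P → Z),
      IsClosedEmbedding e →
        ∃ U : Set Z, IsOpen U ∧ range e ⊆ U ∧
          ∃ r : C(U, P), ∀ (p : P) (hp : e p ∈ U), r ⟨e p, hp⟩ = p

/-- `𝒰` is an open cover of `Y`. -/
def IsOpenCovering {Y : Type v} [TopologicalSpace Y] (𝒰 : Set (Set Y)) : Prop :=
  (∀ U ∈ 𝒰, IsOpen U) ∧ ⋃₀ 𝒰 = univ

/-- `B(f, 𝒰)`: the set of all maps that are `𝒰`-close to `f`. -/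
def coverBall {X : Type u} {Y : Type v} [TopologicalSpace X] [TopologicalSpace Y]
    (f : C(X, Y)) (𝒰 : Set (Set Y)) : Set C(X, Y) :=
  {g | ∀ x, ∃ U ∈ 𝒰, f x ∈ U ∧ g x ∈ U}

/-- The limitation topology on `C(X, Y)`: a set is open iff together with each map `f` it contains
`B(f, 𝒰)` for some open cover `𝒰` of `Y`.  For metrizable `Y` the sets `B(f, 𝒰)` form a
neighbourhood base at `f`, see `mem_nhds_limitationTopology`. -/
@[reducible]
def limitationTopology (X : Type u) (Y : Type v) [TopologicalSpace X] [TopologicalSpace Y] :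
    TopologicalSpace C(X, Y) where
  IsOpen O := ∀ f ∈ O, ∃ 𝒰 : Set (Set Y), IsOpenCovering 𝒰 ∧ coverBall f 𝒰 ⊆ O
  isOpen_univ := fun _ _ => ⟨{univ}, ⟨by simp, by simp⟩, subset_univ _⟩
  isOpen_inter := by
    rintro s t hs ht f ⟨hfs, hft⟩
    obtain ⟨𝒰, ⟨hU, hU'⟩, hUs⟩ := hs f hfs
    obtain ⟨𝒱, ⟨hV, hV'⟩, hVt⟩ := ht f hft
    refine ⟨{W | ∃ U ∈ 𝒰, ∃ V ∈ 𝒱, W = U ∩ V}, ⟨?_, ?_⟩, ?_⟩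
    · rintro _ ⟨U, h1, V, h2, rfl⟩
      exact (hU U h1).inter (hV V h2)
    · refine eq_univ_of_forall fun y => ?_
      obtain ⟨U, h1, h1'⟩ : y ∈ ⋃₀ 𝒰 := hU' ▸ mem_univ y
      obtain ⟨V, h2, h2'⟩ : y ∈ ⋃₀ 𝒱 := hV' ▸ mem_univ y
      exact ⟨U ∩ V, ⟨U, h1, V, h2, rfl⟩, h1', h2'⟩
    · intro g hg
      refine ⟨hUs fun x => ?_, hVt fun x => ?_⟩
      · obtain ⟨_, ⟨U, h1, V, h2, rfl⟩, h3, h4⟩ := hg x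
        exact ⟨U, h1, h3.1, h4.1⟩
      · obtain ⟨_, ⟨U, h1, V, h2, rfl⟩, h3, h4⟩ := hg x
        exact ⟨V, h2, h3.2, h4.2⟩
  isOpen_sUnion := by
    rintro S hS f ⟨s, hs, hfs⟩
    obtain ⟨𝒰, hU, hUs⟩ := hS s hs f hfs
    exact ⟨𝒰, hU, hUs.trans (subset_sUnion_of_mem hs)⟩

/-- The sets `B(f, 𝒰)`, with `𝒰` an open cover, form a neighbourhood base at `f`. -/
theorem mem_nhds_limitationTopology {X : Type u} {Y : Type v} [TopologicalSpace X]
    [TopologicalSpace Y] [TopologicalSpace.MetrizableSpace Y] (f : C(X, Y)) (S : Set C(X, Y)) :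
    S ∈ @nhds _ (limitationTopology X Y) f ↔
      ∃ 𝒰 : Set (Set Y), IsOpenCovering 𝒰 ∧ coverBall f 𝒰 ⊆ S := by
  let _ : MetricSpace Y := TopologicalSpace.metrizableSpaceMetric Y
  have self : ∀ (k : C(X, Y)) (𝒰 : Set (Set Y)), IsOpenCovering 𝒰 → k ∈ coverBall k 𝒰 := by
    intro k 𝒰 hU x
    obtain ⟨U, h1, h2⟩ : k x ∈ ⋃₀ 𝒰 := hU.2 ▸ mem_univ _
    exact ⟨U, h1, h2, h2⟩
  refine (@mem_nhds_iff _ (limitationTopology X Y) f S).trans ?_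
  constructor
  · rintro ⟨O, hOS, hO, hf⟩
    obtain ⟨𝒰, hU, h⟩ := hO f hf
    exact ⟨𝒰, hU, h.trans hOS⟩
  · rintro h
    refine ⟨{g | ∃ 𝒰 : Set (Set Y), IsOpenCovering 𝒰 ∧ coverBall g 𝒰 ⊆ S}, ?_, ?_, h⟩
    · rintro g ⟨𝒰, hU, hg⟩
      exact hg (self g 𝒰 hU)
    · rintro g ⟨𝒰, hU, hg⟩
      let 𝒱 : Set (Set Y) :=
        {V | ∃ (y : Y) (ε : ℝ), 0 < ε ∧ (∃ U ∈ 𝒰, Metric.ball y ε ⊆ U) ∧ V = Metric.ball y (ε / 4)}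
      have hV : IsOpenCovering 𝒱 := by
        refine ⟨?_, eq_univ_of_forall fun y => ?_⟩
        · rintro _ ⟨y, ε, -, -, rfl⟩
          exact Metric.isOpen_ball
        · obtain ⟨U, h1, h2⟩ : y ∈ ⋃₀ 𝒰 := hU.2 ▸ mem_univ y
          obtain ⟨ε, hε, h3⟩ := Metric.isOpen_iff.1 (hU.1 U h1) y h2
          exact ⟨_, ⟨y, ε, hε, ⟨U, h1, h3⟩, rfl⟩, Metric.mem_ball_self (by positivity)⟩
      refine ⟨𝒱, hV, fun k hk => ⟨𝒱, hV, fun l hl => hg fun x => ?_⟩⟩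
      obtain ⟨_, ⟨y, ε, hε, ⟨U, hU1, hU2⟩, rfl⟩, h1, h2⟩ := hk x
      obtain ⟨_, ⟨z, δ, hδ, ⟨W, hW1, hW2⟩, rfl⟩, h3, h4⟩ := hl x
      rw [Metric.mem_ball] at h1 h2 h3 h4
      rcases le_total δ ε with hle | hle
      · refine ⟨U, hU1, hU2 ?_, hU2 ?_⟩ <;> rw [Metric.mem_ball]
        · linarith
        · linarith [dist_triangle (l x) z y, dist_triangle z (k x) y, dist_comm (k x) z]
      · refine ⟨W, hW1, hW2 ?_, hW2 ?_⟩ <;> rw [Metric.mem_ball]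
        · linarith [dist_triangle (g x) y z, dist_triangle y (k x) z, dist_comm (k x) y]
        · linarith

/-- The restriction of a map `g : X → Y` to a map `S → P`, where `g(S) ⊆ P`. -/
def restrictTo {X : Type u} {Y : Type v} [TopologicalSpace X] [TopologicalSpace Y]
    (g : C(X, Y)) (S : Set X) (P : Set Y) (hg : MapsTo g S P) : C(S, P) :=
  ⟨hg.restrict g S P, g.continuous.restrict hg⟩

/-! This is a Baire category argument on `Aᶜ`. Write each `Gn n` as a countable intersection of
dense open sets and enumerate all of these. Starting from `f`, move the map a little at each stage
so that its restriction enters the next open set. Openness leaves a positive tolerance, a function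
on `P`, that all later moves respect. The tolerances shrink geometrically, so the maps converge
uniformly in a complete metric of `P`.

A move starts from a nearby restriction supplied by density, which must be extended with control:
`IsANR.exists_controlled_extension` interpolates linearly in a Banach space containing `P` and
retracts back. Covers of `P` do not see points of the domain, so closeness relative to `lam` needs
the positive infimum on each `An n`, and the map is left unchanged where `lam` is small.

Finally `lam` is cut down by a weight `μ` that vanishes exactly on `A` but has a positive lower
bound on each `An n`; this makes the limit fit continuously with `f` along `A`. -/

/-! ### Extension of maps into Banach spaces -/

/-- A map from a closed subspace into a convex set `C` is approximated by maps of the whole space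
into `C`. -/
theorem exists_approx_extension {Z B E : Type*} [TopologicalSpace Z] [NormalSpace Z]
    [ParacompactSpace Z] [TopologicalSpace B] [NormedAddCommGroup E] [NormedSpace ℝ E]
    {e : B → Z} (he : IsClosedEmbedding e) {C : Set E} (hC : Convex ℝ C) (hne : C.Nonempty)
    (g : C(B, E)) (hg : ∀ b, g b ∈ C) {ε : ℝ} (hε : 0 < ε) :
    ∃ φ : C(Z, E), (∀ z, φ z ∈ C) ∧ ∀ b, ‖g b - φ (e b)‖ ≤ ε := by
  -- Locally constant selections of `t` exist: the value `g b` near `e b`, any point of `C` off the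
  -- closed range. Convexity lets a partition of unity glue them.
  let t : Z → Set E := fun z => C ∩ {v | ∀ b, e b = z → v ∈ Metric.closedBall (g b) ε}
  have ht : ∀ z, Convex ℝ (t z) := by
    intro z
    refine hC.inter ?_
    simp only [ofPred_forall]
    exact convex_iInter fun b => convex_iInter fun _ => convex_closedBall _ _
  have hloc : ∀ z, ∃ c, ∀ᶠ y in 𝓝 z, c ∈ t y := by
    intro z
    by_cases hz : z ∈ range e
    · obtain ⟨b, rfl⟩ := hz
      refine ⟨g b, ?_⟩
      have h1 : ∀ᶠ b' in 𝓝 b, g b ∈ Metric.closedBall (g b') ε := by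
        filter_upwards [g.continuous.continuousAt.eventually (Metric.closedBall_mem_nhds (g b) hε)]
          with b' hb'
        exact Metric.mem_closedBall_comm.1 hb'
      rw [he.isEmbedding.nhds_eq_comap, Filter.eventually_comap] at h1
      filter_upwards [h1] with y hy
      exact ⟨hg b, fun b' hb' => hy b' hb'⟩
    · obtain ⟨c, hc⟩ := hne
      refine ⟨c, ?_⟩
      filter_upwards [he.isClosed_range.isOpen_compl.mem_nhds hz] with y hy
      exact ⟨hc, fun b hb => (hy ⟨b, hb⟩).elim⟩
  obtain ⟨φ, hφ⟩ := exists_continuous_forall_mem_convex_of_local_const ht hloc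
  refine ⟨φ, fun z => (hφ z).1, fun b => ?_⟩
  rw [← dist_eq_norm, dist_comm]
  exact (hφ (e b)).2 b rfl

/-- A map from a closed subspace of a paracompact normal space into a Banach space extends to the
whole space. -/
theorem exists_extension_banach {Z B E : Type*} [TopologicalSpace Z] [NormalSpace Z]
    [ParacompactSpace Z] [TopologicalSpace B] [NormedAddCommGroup E] [NormedSpace ℝ E]
    [CompleteSpace E] {e : B → Z} (he : IsClosedEmbedding e) (g : C(B, E)) :
    ∃ F : C(Z, E), ∀ b, F (e b) = g b := by
  obtain ⟨φ₀, -, hφ₀⟩ := exists_approx_extension he convex_univ univ_nonempty g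
    (fun _ => mem_univ _) one_pos
  -- The bound on `r` sits inside the existential so that `choose` gives a correction for every `r`;
  -- the value `0` is a dummy.
  have step : ∀ (n : ℕ) (r : C(B, E)), ∃ φ : C(Z, E), (∀ b, ‖r b‖ ≤ (1 / 2 : ℝ) ^ n) →
      (∀ z, ‖φ z‖ ≤ (1 / 2 : ℝ) ^ n) ∧ ∀ b, ‖r b - φ (e b)‖ ≤ (1 / 2 : ℝ) ^ (n + 1) := by
    intro n r
    by_cases hr : ∀ b, ‖r b‖ ≤ (1 / 2 : ℝ) ^ n
    · obtain ⟨φ, h1, h2⟩ := exists_approx_extension he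
        (convex_closedBall (0 : E) ((1 / 2 : ℝ) ^ n)) ⟨0, by simp⟩ r (fun b => by simpa using hr b)
        (show (0 : ℝ) < (1 / 2 : ℝ) ^ (n + 1) by positivity)
      exact ⟨φ, fun _ => ⟨fun z => by simpa using h1 z, h2⟩⟩
    · exact ⟨0, fun h => (hr h).elim⟩
  choose φ hφ using step
  let e' : C(B, Z) := ⟨e, he.continuous⟩
  let r : ℕ → C(B, E) := fun n =>
    Nat.rec (g - φ₀.comp e') (fun n r => r - (φ n r).comp e') n
  have hr_succ : ∀ n b, r (n + 1) b = r n b - φ n (r n) (e b) := fun _ _ => rfl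
  have hr : ∀ n b, ‖r n b‖ ≤ (1 / 2 : ℝ) ^ n := by
    intro n
    induction n with
    | zero =>
      rw [pow_zero]
      exact hφ₀
    | succ n ih => exact (hφ n (r n) ih).2
  have hbound : ∀ n z, ‖φ n (r n) z‖ ≤ (1 / 2 : ℝ) ^ n := fun n => (hφ n (r n) (hr n)).1
  have hsum : Summable fun n : ℕ => (1 / 2 : ℝ) ^ n := summable_geometric_two
  refine ⟨φ₀ + ⟨fun z => ∑' n, φ n (r n) z,
    continuous_tsum (fun n => (φ n (r n)).continuous) hsum hbound⟩, fun b => ?_⟩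
  have hpartial : ∀ n, ∑ i ∈ Finset.range n, φ i (r i) (e b) = r 0 b - r n b := by
    intro n
    induction n with
    | zero => simp
    | succ n ih => rw [Finset.sum_range_succ, ih, hr_succ]; abel
  have hlim : Filter.Tendsto (fun n => r n b) Filter.atTop (𝓝 0) :=
    squeeze_zero_norm (fun n => hr n b) (tendsto_pow_atTop_nhds_zero_of_lt_one
      (by norm_num) (by norm_num))
  have h1 : HasSum (fun n => φ n (r n) (e b)) (r 0 b) := by
    rw [(Summable.of_norm_bounded hsum fun n => hbound n (e b)).hasSum_iff_tendsto_nat]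
    simpa [hpartial] using hlim.const_sub (r 0 b)
  change φ₀ (e b) + ∑' n, φ n (r n) (e b) = g b
  rw [h1.tsum_eq]
  change φ₀ (e b) + (g b - φ₀ (e b)) = g b
  abel

/-! ### Controlled extension of maps into an ANR -/

/-- Every metric space embeds isometrically into a Banach space in the same universe. -/
theorem exists_isometry_boundedContinuousFunction (P : Type v) [MetricSpace P] :
    ∃ φ : P → BoundedContinuousFunction P ℝ, Isometry φ := by
  rcases isEmpty_or_nonempty P with hP | ⟨⟨p₀⟩⟩
  · exact ⟨fun _ => 0, fun p => (hP.false p).elim⟩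
  -- Kuratowski embedding; subtracting the distance to `p₀` makes the functions bounded.
  let φ : P → BoundedContinuousFunction P ℝ := fun p =>
    BoundedContinuousFunction.ofNormedAddCommGroup (fun x => dist x p - dist x p₀) (by fun_prop)
      (dist p p₀) fun x => by
        rw [Real.norm_eq_abs, dist_comm x p, dist_comm x p₀, dist_comm p p₀, abs_le]
        constructor <;>
        linarith [dist_triangle p p₀ x, dist_triangle p₀ p x, dist_comm p p₀]
  refine ⟨φ, Isometry.of_dist_eq fun p q => le_antisymm ?_ ?_⟩
  · refine (BoundedContinuousFunction.dist_le dist_nonneg).2 fun x => ?_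
    change dist (dist x p - dist x p₀) (dist x q - dist x p₀) ≤ _
    rw [dist_sub_right, dist_comm x p, dist_comm x q]
    exact dist_dist_dist_le_left p q x
  · have h := BoundedContinuousFunction.dist_coe_le_dist (f := φ p) (g := φ q) q
    change dist (dist q p - dist q p₀) (dist q q - dist q p₀) ≤ _ at h
    rwa [dist_sub_right, dist_self, Real.dist_0_eq_abs, abs_of_nonneg dist_nonneg,
      dist_comm q p] at h

/-- Let `M` be an open neighbourhood of the diagonal of a completely metrizable ANR `P`. If a map
`g` on a closed subspace is sufficiently close to the restriction of `h`, then it extends to a map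
`h'` that is `M`-close to `h` and equals `h` off a given neighbourhood of the subspace. -/
theorem IsANR.exists_controlled_extension {P : Type v} [MetricSpace P] [CompleteSpace P]
    (hP : IsANR P) {M : Set (P × P)} (hM : IsOpen M) (hdiag : ∀ p, (p, p) ∈ M) :
    ∃ 𝒱 : Set (Set P), IsOpenCovering 𝒱 ∧
      ∀ {Z B : Type u} [TopologicalSpace Z] [NormalSpace Z] [ParacompactSpace Z]
        [TopologicalSpace B] (e : C(B, Z)), IsClosedEmbedding e →
        ∀ (h : C(Z, P)), ∀ g ∈ coverBall (h.comp e) 𝒱, ∀ W : Set Z, IsOpen W → range e ⊆ W →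
          ∃ h' : C(Z, P), h'.comp e = g ∧ (∀ z, (h z, h' z) ∈ M) ∧ ∀ z ∉ W, h' z = h z := by
  obtain ⟨φ, hφ⟩ := exists_isometry_boundedContinuousFunction P
  have hφc : Continuous φ := hφ.continuous
  obtain ⟨U, hUo, hU, r, hr⟩ := hP.2 _ φ hφ.isClosedEmbedding
  let T : Set (P × BoundedContinuousFunction P ℝ) :=
    (Prod.map id Subtype.val) '' {x : P × U | (x.1, r x.2) ∈ M}
  have hT : IsOpen T :=
    (IsOpenEmbedding.id.prodMap hUo.isOpenEmbedding_subtypeVal).isOpenMap _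
      (hM.preimage (by fun_prop))
  have hTφ : ∀ p, (p, φ p) ∈ T := fun p =>
    ⟨(p, ⟨φ p, hU (mem_range_self p)⟩), by simpa [hr] using hdiag p, rfl⟩
  have hTM : ∀ p v, (p, v) ∈ T → ∃ hv : v ∈ U, (p, r ⟨v, hv⟩) ∈ M := by
    rintro p v ⟨⟨p', v'⟩, h, h'⟩
    obtain ⟨rfl, rfl⟩ := Prod.mk.inj h'
    exact ⟨v'.2, h⟩
  -- The whole segment from `φ p` to `v` must stay in `T`; compactness of `[0, 1]` makes this an
  -- open condition.
  let N : Set (P × BoundedContinuousFunction P ℝ) :=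
    {x | ∀ t ∈ Icc (0 : ℝ) 1, (x.1, φ x.1 + t • (x.2 - φ x.1)) ∈ T}
  have hN : IsOpen N := by
    refine isOpen_iff_mem_nhds.2 fun x hx => ?_
    refine isCompact_Icc.eventually_forall_of_forall_eventually fun t ht => ?_
    have hc : Continuous fun y : (P × BoundedContinuousFunction P ℝ) × ℝ =>
        (y.1.1, φ y.1.1 + y.2 • (y.1.2 - φ y.1.1)) := by fun_prop
    exact hc.continuousAt.eventually (hT.mem_nhds (hx t ht))
  have hNφ : ∀ p, (p, φ p) ∈ N := fun p t _ => by simpa using hTφ p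
  refine ⟨{V | IsOpen V ∧ ∀ p ∈ V, ∀ q ∈ V, (p, φ q) ∈ N},
    ⟨fun V hV => hV.1, eq_univ_of_forall fun p => ?_⟩, ?_⟩
  · have : {x : P × P | (x.1, φ x.2) ∈ N} ∈ 𝓝 (p, p) :=
      (hN.preimage (by fun_prop : Continuous fun x : P × P => (x.1, φ x.2))).mem_nhds (hNφ p)
    rw [nhds_prod_eq] at this
    obtain ⟨V, hV, hVN⟩ := Filter.mem_prod_same_iff.1 this
    exact ⟨interior V, ⟨isOpen_interior, fun q hq q' hq' =>
      hVN (mk_mem_prod (interior_subset hq) (interior_subset hq'))⟩,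
      mem_interior_iff_mem_nhds.2 hV⟩
  · intro Z B _ _ _ _ e he h g hg W hW heW
    obtain ⟨D, hD⟩ := exists_extension_banach he ((⟨φ, hφc⟩ : C(P, _)).comp g)
    have hS : IsOpen (W ∩ {z | (h z, D z) ∈ N}) := hW.inter (hN.preimage (by fun_prop))
    have hBS : Disjoint (W ∩ {z | (h z, D z) ∈ N})ᶜ (range e) := by
      rw [disjoint_compl_left_iff_subset]
      rintro _ ⟨b, rfl⟩
      refine ⟨heW (mem_range_self b), ?_⟩
      obtain ⟨V, hV, h1, h2⟩ := hg b
      change (h (e b), D (e b)) ∈ N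
      rw [hD]
      exact hV.2 _ h1 _ h2
    -- The new map is `r (φ h + τ (D - φ h))`: it is `g` where `τ = 1` and `h` where `τ = 0`.
    obtain ⟨τ, hτ0, hτ1, hτ⟩ :=
      exists_continuous_zero_one_of_isClosed hS.isClosed_compl he.isClosed_range hBS
    have hFT : ∀ z, (h z, φ (h z) + τ z • (D z - φ (h z))) ∈ T := by
      intro z
      by_cases hz : z ∈ W ∩ {z | (h z, D z) ∈ N}
      · exact hz.2 _ (hτ z)
      · have : τ z = 0 := hτ0 hz
        simpa [this] using hTφ (h z)
    choose hFU hFM using fun z => hTM _ _ (hFT z)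
    refine ⟨⟨fun z => r ⟨_, hFU z⟩, by fun_prop⟩, ?_, hFM, fun z hz => ?_⟩
    · ext b
      have h1 : τ (e b) = 1 := hτ1 (mem_range_self b)
      have h2 : φ (h (e b)) + τ (e b) • (D (e b) - φ (h (e b))) = φ (g b) := by
        rw [h1, hD]
        simp
      change r ⟨_, hFU (e b)⟩ = g b
      rw [← hr (g b) (hU (mem_range_self _))]
      congr 2
    · have h1 : τ z = 0 := hτ0 fun h => hz h.1
      have h2 : φ (h z) + τ z • (D z - φ (h z)) = φ (h z) := by simp [h1]
      change r ⟨_, hFU z⟩ = h z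
      refine Eq.trans ?_ (hr (h z) (hU (mem_range_self _)))
      congr 2

/-! ### The Baire-type construction -/

/-- Every open cover of a metric space has a positive `1`-Lipschitz Lebesgue function. -/
theorem IsOpenCovering.exists_lebesgue_function {P : Type v} [PseudoMetricSpace P]
    {𝒲 : Set (Set P)} (h𝒲 : IsOpenCovering 𝒲) :
    ∃ η : P → ℝ, (∀ p, 0 < η p) ∧ (∀ p q, η p ≤ η q + dist p q) ∧
      ∀ p, ∃ W ∈ 𝒲, Metric.ball p (η p) ⊆ W := by
  let R : P → Set ℝ := fun p => {r | r ≤ 1 ∧ ∃ W ∈ 𝒲, Metric.ball p r ⊆ W}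
  have hbdd : ∀ p, BddAbove (R p) := fun p => ⟨1, fun r hr => hr.1⟩
  have hpos : ∀ p, ∃ r ∈ R p, 0 < r := by
    intro p
    obtain ⟨W, hW, hpW⟩ : p ∈ ⋃₀ 𝒲 := h𝒲.2 ▸ mem_univ p
    obtain ⟨ε, hε, hεW⟩ := Metric.isOpen_iff.1 (h𝒲.1 W hW) p hpW
    exact ⟨min ε 1, ⟨min_le_right _ _, W, hW,
      (Metric.ball_subset_ball (min_le_left _ _)).trans hεW⟩, by positivity⟩
  have hs : ∀ p, 0 < sSup (R p) := fun p =>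
    let ⟨_, hr, hr0⟩ := hpos p
    hr0.trans_le (le_csSup (hbdd p) hr)
  have hne : ∀ p, (R p).Nonempty := fun p => let ⟨r, hr, _⟩ := hpos p; ⟨r, hr⟩
  -- Half the supremum, since the supremum need not be attained.
  refine ⟨fun p => sSup (R p) / 2, fun p => half_pos (hs p), fun p q => ?_, fun p => ?_⟩
  · have : sSup (R p) ≤ sSup (R q) + dist p q := by
      refine csSup_le (hne p) fun r ⟨hr1, W, hW, hrW⟩ => ?_
      have : r - dist p q ≤ sSup (R q) :=
        le_csSup (hbdd q) ⟨by linarith [dist_nonneg (x := p) (y := q)], W, hW,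
          (Metric.ball_subset_ball' (by rw [dist_comm q p]; linarith)).trans hrW⟩
      linarith
    linarith [dist_nonneg (x := p) (y := q)]
  · obtain ⟨r, ⟨-, W, hW, hrW⟩, hr⟩ := exists_lt_of_lt_csSup (hne p) (half_lt_self (hs p))
    exact ⟨W, hW, (Metric.ball_subset_ball hr.le).trans hrW⟩

/-- A dense set in the limitation topology contains maps arbitrarily close to a given one. -/
theorem exists_mem_coverBall_of_dense {B : Type u} {P : Type v} [TopologicalSpace B]
    [TopologicalSpace P] [TopologicalSpace.MetrizableSpace P] {O : Set C(B, P)}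
    (hO : @Dense _ (limitationTopology B P) O) (f : C(B, P)) {𝒱 : Set (Set P)}
    (h𝒱 : IsOpenCovering 𝒱) : ∃ g ∈ O, g ∈ coverBall f 𝒱 := by
  let _ := limitationTopology B P
  obtain ⟨g, hg, hgO⟩ := mem_closure_iff_nhds.1 (hO f) (coverBall f 𝒱)
    ((mem_nhds_limitationTopology f _).2 ⟨𝒱, h𝒱, Subset.rfl⟩)
  exact ⟨g, hgO, hg⟩

/-- A map `h : Z → P` is moved slightly, so that its restriction to a closed subspace gets into a
dense open set `O` of maps and stays there under further moves controlled by `θ'`. -/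
theorem IsANR.exists_move_into_dense_open {P : Type v} [MetricSpace P] [CompleteSpace P]
    (hP : IsANR P) {Y : Type*} [PseudoMetricSpace Y] (j : C(P, Y)) {Z B : Type u}
    [TopologicalSpace Z] [NormalSpace Z] [ParacompactSpace Z] [TopologicalSpace B]
    {e : C(B, Z)} (he : IsClosedEmbedding e) {O : Set C(B, P)}
    (hO : IsOpen[limitationTopology B P] O) (hOd : @Dense _ (limitationTopology B P) O)
    (lam : C(Z, ℝ)) (hlam : ∀ z, 0 < lam z) (hinf : ∃ c > 0, ∀ b, c ≤ lam (e b))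
    (h : C(Z, P)) {θ : P → ℝ} (hθ : ∀ p, 0 < θ p) (hθL : ∀ p q, θ p ≤ θ q + dist p q) :
    ∃ (h' : C(Z, P)) (θ' : P → ℝ), (∀ p, 0 < θ' p) ∧ (∀ p q, θ' p ≤ θ' q + dist p q) ∧
      (∀ p, θ' p ≤ θ p / 4) ∧ (∀ z, dist (h z) (h' z) < θ (h z)) ∧
      (∀ z, dist (j (h z)) (j (h' z)) ≤ lam z) ∧
      ∀ k : C(Z, P), (∀ z, dist (h' z) (k z) < 4 * θ' (h' z)) → k.comp e ∈ O := by
  obtain ⟨c, hc, hcl⟩ := hinf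
  have hθc : Continuous θ := by
    have : LipschitzWith 1 θ := LipschitzWith.of_le_add hθL
    exact this.continuous
  -- `j` moves by less than `c / 2`, and only where `lam > c / 2`. The metric of `Y` is treated
  -- separately, as it need not be the complete one on `P`.
  obtain ⟨𝒱, h𝒱, hext⟩ := hP.exists_controlled_extension
    (M := {x | dist x.1 x.2 < θ x.1} ∩ {x | dist (j x.1) (j x.2) < c / 2})
    ((isOpen_lt (by fun_prop) (by fun_prop)).inter (isOpen_lt (by fun_prop) (by fun_prop)))
    fun p => ⟨by simpa using hθ p, by simpa using hc⟩
  obtain ⟨g, hgO, hg⟩ := exists_mem_coverBall_of_dense hOd (h.comp e) h𝒱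
  obtain ⟨h', hh'g, hh'M, hh'W⟩ := hext e he h g hg {z | c / 2 < lam z}
    (isOpen_lt continuous_const lam.continuous)
    (by rintro _ ⟨b, rfl⟩; exact (half_lt_self hc).trans_le (hcl b))
  obtain ⟨𝒲, h𝒲, h𝒲O⟩ := hO g hgO
  obtain ⟨η, hη, hηL, hηW⟩ := h𝒲.exists_lebesgue_function
  refine ⟨h', fun p => min (θ p) (η p) / 4, fun p => ?_, fun p q => ?_, fun p => ?_,
    fun z => (hh'M z).1, fun z => ?_, fun k hk => h𝒲O fun b => ?_⟩
  · have := lt_min (hθ p) (hη p)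
    linarith
  · have h1 : min (θ p) (η p) ≤ min (θ q) (η q) + dist p q := by
      rw [min_add]
      exact min_le_min (hθL p q) (hηL p q)
    linarith [dist_nonneg (x := p) (y := q)]
  · have := min_le_left (θ p) (η p)
    linarith
  · by_cases hz : c / 2 < lam z
    · exact ((hh'M z).2.trans hz).le
    · rw [hh'W z hz, dist_self]
      exact (hlam z).le
  · have hb : h' (e b) = g b := DFunLike.congr_fun hh'g b
    obtain ⟨W, hW, hbW⟩ := hηW (g b)
    refine ⟨W, hW, hbW (Metric.mem_ball_self (hη _)), hbW ?_⟩
    have h1 := hk (e b)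
    rw [hb] at h1
    have h2 := min_le_right (θ (g b)) (η (g b))
    rw [Metric.mem_ball, dist_comm]
    change dist (g b) (k (e b)) < _
    linarith

/-- Given dense open sets of maps on countably many closed subspaces, every map into a completely
metrizable ANR is approximated by maps whose restrictions belong to all of them. -/
theorem IsANR.exists_approx_mem_dense_open {P : Type v} [TopologicalSpace P]
    [TopologicalSpace.IsCompletelyMetrizableSpace P]
    (hP : IsANR P) {Y : Type*} [PseudoMetricSpace Y] (j : C(P, Y)) {Z : Type u}
    [TopologicalSpace Z] [NormalSpace Z] [ParacompactSpace Z]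
    {B : ℕ → Type u} [∀ n, TopologicalSpace (B n)]
    {e : ∀ n, C(B n, Z)} (he : ∀ n, IsClosedEmbedding (e n)) {O : ∀ n, Set C(B n, P)}
    (hO : ∀ n, IsOpen[limitationTopology (B n) P] (O n))
    (hOd : ∀ n, @Dense _ (limitationTopology (B n) P) (O n))
    (lam : C(Z, ℝ)) (hlam : ∀ z, 0 < lam z) (hinf : ∀ n, ∃ c > 0, ∀ b, c ≤ lam (e n b))
    (f : C(Z, P)) {𝒲 : Set (Set P)} (h𝒲 : IsOpenCovering 𝒲) :
    ∃ h ∈ coverBall f 𝒲, (∀ n, h.comp (e n) ∈ O n) ∧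
      ∀ z, dist (j (h z)) (j (f z)) < lam z := by
  let _ := TopologicalSpace.upgradeIsCompletelyMetrizable P
  obtain ⟨η, hη, hηL, hηW⟩ := h𝒲.exists_lebesgue_function
  let S := C(Z, P) × {θ : P → ℝ // (∀ p, 0 < θ p) ∧ ∀ p q, θ p ≤ θ q + dist p q}
  have step : ∀ (n : ℕ) (s : S), ∃ s' : S, (∀ p, s'.2.1 p ≤ s.2.1 p / 4) ∧
      (∀ z, dist (s.1 z) (s'.1 z) < s.2.1 (s.1 z)) ∧
      -- These bounds sum to `lam z / 2`, leaving room for the strict inequality.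
      (∀ z, dist (j (s.1 z)) (j (s'.1 z)) ≤ lam z / 2 / 2 / 2 ^ n) ∧
      ∀ k : C(Z, P), (∀ z, dist (s'.1 z) (k z) < 4 * s'.2.1 (s'.1 z)) → k.comp (e n) ∈ O n := by
    rintro n ⟨h, θ, hθ, hθL⟩
    obtain ⟨h', θ', h1, h2, h3⟩ := hP.exists_move_into_dense_open j (he n) (hO n) (hOd n)
      ⟨fun z => lam z / 2 / 2 / 2 ^ n, by fun_prop⟩
      (fun z => by have := hlam z; change 0 < lam z / 2 / 2 / 2 ^ n; positivity)
      (by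
        obtain ⟨c, hc, hcl⟩ := hinf n
        refine ⟨c / 2 / 2 / 2 ^ n, by positivity, fun b => ?_⟩
        change _ ≤ lam (e n b) / 2 / 2 / 2 ^ n
        have := hcl b
        gcongr) h hθ hθL
    exact ⟨(h', ⟨θ', h1, h2⟩), h3⟩
  choose next hnext using step
  -- The cap `1` makes the convergence uniform; the factor `1 / 4` keeps the total displacement, at
  -- most twice the tolerance, below `η`.
  let s₀ : S := (f, ⟨fun p => min (η p) 1 / 4, fun p => by have := hη p; positivity, fun p q => by
    have h1 : min (η p) 1 ≤ min (η q) 1 + dist p q := by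
      rw [min_add]
      exact min_le_min (hηL p q) (by linarith [dist_nonneg (x := p) (y := q)])
    linarith [dist_nonneg (x := p) (y := q)]⟩)
  let s : ℕ → S := fun n => Nat.rec s₀ next n
  have hs : ∀ n, s (n + 1) = next n (s n) := fun _ => rfl
  let a : ℕ → Z → ℝ := fun n z => (s n).2.1 ((s n).1 z)
  have ha : ∀ n z, 0 < a n z := fun n z => (s n).2.2.1 _
  -- The Lipschitz bound at most doubles the old tolerance along the move; the quarter then turns
  -- this into a half.
  have ha_succ : ∀ n z, a (n + 1) z ≤ a n z / 2 := by
    intro n z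
    have h1 := (hnext n (s n)).1 ((s (n + 1)).1 z)
    have h2 := (hnext n (s n)).2.1 z
    have h3 := (s n).2.2.2 ((s (n + 1)).1 z) ((s n).1 z)
    rw [dist_comm] at h3
    rw [← hs] at h1 h2
    simp only [a]
    linarith
  have ha_add : ∀ n z k, a (n + k) z ≤ a n z / 2 ^ k := by
    intro n z k
    induction k with
    | zero => simp
    | succ k ih =>
      have := ha_succ (n + k) z
      rw [pow_succ, ← div_div]
      change a (n + k + 1) z ≤ _
      linarith
  have hdist : ∀ n z k,
      dist ((s (n + k)).1 z) ((s (n + k + 1)).1 z) ≤ 2 * a n z / 2 / 2 ^ k := by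
    intro n z k
    have h1 := ha_add n z k
    have h2 := (hnext (n + k) (s (n + k))).2.1 z
    rw [mul_div_cancel_left₀ _ (two_ne_zero' ℝ)]
    exact h2.le.trans h1
  have hcauchy : ∀ z, ∃ p, Filter.Tendsto (fun n => (s n).1 z) Filter.atTop (𝓝 p) := fun z =>
    cauchySeq_tendsto_of_complete (cauchySeq_of_le_geometric_two (C := 2 * a 0 z)
      fun k => by simpa using hdist 0 z k)
  choose H hH using hcauchy
  have hHdist : ∀ n z, dist ((s n).1 z) (H z) ≤ 2 * a n z := fun n z =>
    dist_le_of_le_geometric_two_of_tendsto₀ (f := fun k => (s (n + k)).1 z) (hdist n z)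
      (by simpa [add_comm] using (Filter.tendsto_add_atTop_iff_nat n).2 (hH z))
  have ha0 : ∀ z, a 0 z ≤ 1 / 4 := fun z => by
    change min (η (f z)) 1 / 4 ≤ _
    linarith [min_le_right (η (f z)) 1]
  have hunif : TendstoUniformly (fun n z => (s n).1 z) H Filter.atTop := by
    refine Metric.tendstoUniformly_iff.2 fun ε hε => ?_
    obtain ⟨N, hN⟩ := exists_pow_lt_of_lt_one hε (by norm_num : (1 / 2 : ℝ) < 1)
    filter_upwards [Filter.eventually_ge_atTop N] with n hn z
    have h1 := ha_add 0 z n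
    have h2 : a 0 z / 2 ^ n ≤ 1 / 4 / 2 ^ n := by gcongr; exact ha0 z
    have h3 : (1 / 2 : ℝ) ^ n ≤ (1 / 2) ^ N :=
      pow_le_pow_of_le_one (by norm_num) (by norm_num) hn
    have h4 : (1 / 4 : ℝ) / 2 ^ n = 1 / 4 * (1 / 2) ^ n := by
      rw [one_div_pow]
      ring
    have h5 : (0 : ℝ) < (1 / 2) ^ n := by positivity
    rw [dist_comm]
    rw [zero_add] at h1
    linarith [hHdist n z]
  have hHc : Continuous H :=
    hunif.continuous (Filter.Frequently.of_forall fun n => (s n).1.continuous)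
  refine ⟨⟨H, hHc⟩, fun z => ?_, fun n => ?_, fun z => ?_⟩
  · obtain ⟨W, hW, hzW⟩ := hηW (f z)
    refine ⟨W, hW, hzW (Metric.mem_ball_self (hη _)), hzW ?_⟩
    have h1 : dist (f z) (H z) ≤ 2 * (min (η (f z)) 1 / 4) := hHdist 0 z
    have h2 := min_le_left (η (f z)) 1
    have h3 := hη (f z)
    rw [Metric.mem_ball, dist_comm]
    change dist (f z) (H z) < _
    linarith
  · refine (hnext n (s n)).2.2.2 _ fun z => ?_
    have h1 := hHdist (n + 1) z
    have h2 := ha (n + 1) z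
    change dist ((s (n + 1)).1 z) (H z) < 4 * a (n + 1) z
    linarith
  · have h1 : dist (j (f z)) (j (H z)) ≤ lam z / 2 :=
      dist_le_of_le_geometric_two_of_tendsto₀ (f := fun n => j ((s n).1 z))
        (fun n => (hnext n (s n)).2.2.1 z) ((j.continuous.tendsto _).comp (hH z))
    rw [dist_comm]
    exact h1.trans_lt (half_lt_self (hlam z))

/-! ### Weights and gluing -/

/-- Given countably many closed sets disjoint from the closed set `A`, there is a nonnegative
function with zero set `A` that is bounded away from zero on each of them. -/
theorem exists_continuous_zero_set_bounded_below {X : Type*} [TopologicalSpace X]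
    [PerfectlyNormalSpace X] {A : Set X} (hA : IsClosed A) {F : ℕ → Set X}
    (hF : ∀ n, IsClosed (F n)) (hAF : ∀ n, Disjoint A (F n)) :
    ∃ μ : C(X, ℝ), (∀ x ∈ A, μ x = 0) ∧ (∀ x ∉ A, 0 < μ x) ∧
      ∀ n, ∃ c > 0, ∀ x ∈ F n, c ≤ μ x := by
  obtain ⟨w, hw, hw01⟩ := perfectlyNormalSpace_iff_forall_isClosed_preimage_zero.1 ‹_› A hA
  choose u hu0 hu1 hu using fun n => exists_continuous_zero_one_of_isClosed hA (hF n) (hAF n)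
  have hsum : Summable fun n : ℕ => (1 / 2 : ℝ) ^ n := summable_geometric_two
  have hnn : ∀ n x, 0 ≤ (1 / 2 : ℝ) ^ n * u n x := fun n x =>
    mul_nonneg (by positivity) (hu n x).1
  have hle : ∀ n x, (1 / 2 : ℝ) ^ n * u n x ≤ (1 / 2) ^ n := fun n x =>
    mul_le_of_le_one_right (by positivity) (hu n x).2
  have hsumx : ∀ x, Summable fun n : ℕ => (1 / 2 : ℝ) ^ n * u n x := fun x =>
    Summable.of_nonneg_of_le (fun n => hnn n x) (fun n => hle n x) hsum
  refine ⟨⟨fun x => w x + ∑' n, (1 / 2 : ℝ) ^ n * u n x, w.continuous.add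
    (continuous_tsum (fun n => by fun_prop) hsum fun n x => ?_)⟩, fun x hx => ?_, fun x hx => ?_,
    fun n => ⟨(1 / 2) ^ n, by positivity, fun x hx => ?_⟩⟩
  · rw [Real.norm_of_nonneg (hnn n x)]
    exact hle n x
  · have h1 : w x = 0 := by rw [hw] at hx; exact hx
    have h2 : ∀ n, u n x = 0 := fun n => hu0 n hx
    simp [h1, h2]
  · have h1 : w x ≠ 0 := fun h => hx (by rw [hw]; exact h)
    exact add_pos_of_pos_of_nonneg ((hw01 x).1.lt_of_ne' h1) (tsum_nonneg fun n => hnn n x)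
  · have h1 : u n x = 1 := hu1 n hx
    have h2 := (hsumx x).le_tsum n fun m _ => hnn m x
    rw [h1, mul_one] at h2
    exact h2.trans (le_add_of_nonneg_left (hw01 x).1)

/-- A map on the complement of a closed set `A` that converges to `f` at `A` is glued with `f|A`. -/
theorem exists_glue {X Y : Type*} [TopologicalSpace X] [PseudoMetricSpace Y] {A : Set X}
    (hA : IsClosed A) (f : C(X, Y)) (g : C((Aᶜ : Set X), Y)) (μ : C(X, ℝ))
    (hμA : ∀ x ∈ A, μ x = 0) (hg : ∀ x : (Aᶜ : Set X), dist (g x) (f x) ≤ μ x) :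
    ∃ h : C(X, Y), EqOn h f A ∧ ∀ x : (Aᶜ : Set X), h x = g x := by
  classical
  let h : X → Y := fun x => if hx : x ∈ A then f x else g ⟨x, hx⟩
  have hfA : ∀ x ∈ A, h x = f x := fun x hx => dif_pos hx
  have hgA : ∀ x : (Aᶜ : Set X), h x = g x := fun x => dif_neg x.2
  -- Holding on all of `X`, this squeezes `h` to `f` at points of `A`.
  have hdist : ∀ x, dist (h x) (f x) ≤ μ x := by
    intro x
    by_cases hx : x ∈ A
    · rw [hfA x hx, dist_self, hμA x hx]
    · exact (hgA ⟨x, hx⟩).symm ▸ hg ⟨x, hx⟩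
  refine ⟨⟨h, continuous_iff_continuousAt.2 fun x => ?_⟩, hfA, hgA⟩
  by_cases hx : x ∈ A
  · rw [ContinuousAt, hfA x hx, tendsto_iff_dist_tendsto_zero]
    have h1 : Filter.Tendsto (fun y => μ y + dist (f y) (f x)) (𝓝 x) (𝓝 0) := by
      have : Continuous fun y => μ y + dist (f y) (f x) := by fun_prop
      simpa [hμA x hx] using this.tendsto x
    refine squeeze_zero (fun _ => dist_nonneg) (fun y => ?_) h1
    linarith [dist_triangle (h y) (f y) (f x), hdist y]
  · have h1 : ContinuousOn h Aᶜ := by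
      rw [continuousOn_iff_continuous_domRestrict]
      exact g.continuous.congr fun y => (hgA y).symm
    exact h1.continuousAt (hA.isOpen_compl.mem_nhds hx)

theorem mainTheorem8 {X : Type u} [TopologicalSpace X] [TopologicalSpace.MetrizableSpace X]
    {Y : Type v} [MetricSpace Y]
    (P : Set Y) (hPcm : TopologicalSpace.IsCompletelyMetrizableSpace P) (hPanr : IsANR P)
    (A : Set X) (hA : IsClosed A)
    (An : ℕ → Set X) (hAn : ∀ n, IsClosed (An n)) (hAne : ∀ n, (An n).Nonempty)
    (hdisj : ∀ n, An n ⊆ Aᶜ)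
    (Gn : ∀ n, Set C(An n, P))
    (hGdense : ∀ n, @Dense _ (limitationTopology (An n) P) (Gn n))
    (hGdelta : ∀ n, @IsGδ _ (limitationTopology (An n) P) (Gn n))
    (lam : C((Aᶜ : Set X), ℝ)) (hlam : ∀ x, 0 < lam x)
    (hinf : ∀ n, 0 < ⨅ x : An n, lam ⟨x, hdisj n x.2⟩)
    (f : C(X, Y)) (hf : MapsTo f Aᶜ P)
    (G : Set C((Aᶜ : Set X), P))
    (hG : G ∈ @nhds _ (limitationTopology (Aᶜ : Set X) P) (restrictTo f Aᶜ P hf)) :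
    ∃ h : C(X, Y), EqOn h f A ∧ ∃ hP : MapsTo h Aᶜ P,
      (∀ n, restrictTo h (An n) P (hP.mono_left (hdisj n)) ∈ Gn n) ∧
      restrictTo h Aᶜ P hP ∈ G ∧
      ∀ x : (Aᶜ : Set X), dist (h x) (f x) < lam x := by
  obtain ⟨𝒲, h𝒲, h𝒲G⟩ := (mem_nhds_limitationTopology _ _).1 hG
  choose O hO hGO using fun n => (@isGδ_iff_eq_iInter_nat _ (limitationTopology (An n) P) _).1
    (hGdelta n)
  have hOd : ∀ n m, @Dense _ (limitationTopology (An n) P) (O n m) := fun n m =>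
    @Dense.mono _ (limitationTopology (An n) P) _ _
      (by rw [hGO n]; exact iInter_subset _ m) (hGdense n)
  obtain ⟨μ, hμA, hμ, hμAn⟩ := exists_continuous_zero_set_bounded_below hA hAn fun n =>
    (disjoint_compl_right (a := A)).mono_right (hdisj n)
  let lam' : C((Aᶜ : Set X), ℝ) := ⟨fun x => min (lam x) (μ x), by fun_prop⟩
  let ι : C(P, Y) := ⟨Subtype.val, continuous_subtype_val⟩
  let e : ∀ n, C(An n, (Aᶜ : Set X)) := fun n => ⟨inclusion (hdisj n), continuous_inclusion _⟩
  have he : ∀ n, IsClosedEmbedding (e n) := fun n =>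
    ⟨IsEmbedding.inclusion (hdisj n), by
      change IsClosed (range (inclusion (hdisj n)))
      rw [range_inclusion]
      exact (hAn n).preimage continuous_subtype_val⟩
  have hinf' : ∀ n, ∃ c > 0, ∀ b, c ≤ lam' (e n b) := by
    intro n
    obtain ⟨c, hc, hcμ⟩ := hμAn n
    refine ⟨min (⨅ x : An n, lam ⟨x, hdisj n x.2⟩) c, lt_min (hinf n) hc, fun b =>
      min_le_min (ciInf_le ⟨0, ?_⟩ b) (hcμ b b.2)⟩
    rintro _ ⟨x, rfl⟩
    exact (hlam _).le
  let _ := TopologicalSpace.metrizableSpaceMetric X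
  obtain ⟨H, hH𝒲, hHO, hHd⟩ := hPanr.exists_approx_mem_dense_open ι
    -- Stage `k` handles the open set `O n m` with `(n, m)` coded by `k`.
    (fun k : ℕ => he k.unpair.1) (fun k => hO _ k.unpair.2) (fun k => hOd _ k.unpair.2) lam'
    (fun z => lt_min (hlam z) (hμ z z.2)) (fun k => hinf' _) (restrictTo f Aᶜ P hf) h𝒲
  obtain ⟨h, hhf, hhH⟩ := exists_glue hA f (ι.comp H) μ hμA fun x =>
    ((hHd x).trans_le (min_le_right _ _)).le
  have hP : MapsTo h Aᶜ P := fun x hx => by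
    rw [hhH ⟨x, hx⟩]
    exact (H ⟨x, hx⟩).2
  have hres : restrictTo h Aᶜ P hP = H := by
    ext x
    exact hhH x
  refine ⟨h, hhf, hP, fun n => ?_, ?_, fun x => ?_⟩
  · have h1 : restrictTo h (An n) P (hP.mono_left (hdisj n)) = H.comp (e n) := by
      ext x
      exact hhH (e n x)
    rw [h1, hGO n]
    refine mem_iInter.2 fun m => ?_
    have h2 := hHO (Nat.pair n m)
    rw [Nat.unpair_pair] at h2
    exact h2
  · rw [hres]
    exact h𝒲G hH𝒲
  · rw [hhH x]
    exact (hHd x).trans_le (min_le_left _ _)
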